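/- Let $C_3$ be the triangle graph with a nonzero real weight $w(e)$ on each of its three edges $e$. An ordered triple $(x_1,x_2,x_3)$ of distinct points of $\mathbb R^2$ is a dot-product $C_3$-configuration if there is a bijection $\varphi: V(C_3)\to\{x_1,x_2,x_3\}$ such that $\varphi(u)\cdot\varphi(v)=w(\{u,v\})$ for every edge $\{u,v\}$ of $C_3$. Let $g(C_3;n)$ denote the maximum, over all sets $E\subset\mathbb R^2$ of exactly $n$ points, of the number of dot-product $C_3$-configurations whose points all lie in $E$. Then $$n\lesssim g(C_3;n)\lesssim n^{4/3},$$ that is, there are constants $C$ and $N$, independent of $n$ and of the weights, such that for all nonzero weights and all $n>N$, $$n\le C\,g(C_3;n)\qquad\text{and}\qquad g(C_3;n)\le C\,n^{4/3}.$$ -/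

import Mathlib

/-- The Euclidean plane. -/
abbrev Plane : Type := EuclideanSpace ℝ (Fin 2)

/-- Let `G` be a graph with edge weights `w` (only the values of `w` on edges of `G` matter).
A `k`-tuple `x` of distinct points of the plane forms a dot product `G`-configuration if there is
a bijection from the vertices of `G` to the entries of `x` such that, for every edge `{u, v}` of
`G`, the dot product of the points assigned to `u` and `v` is the weight of `{u, v}`. -/
def IsDotProductConfig {V : Type*} (G : SimpleGraph V) (w : Sym2 V → ℝ) {k : ℕ}
    (x : Fin k → Plane) : Prop :=
  Function.Injective x ∧
    ∃ φ : V ≃ Fin k, ∀ u v : V, G.Adj u v → inner ℝ (x (φ u)) (x (φ v)) = w s(u, v)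

/-- The set of dot product `G`-configurations all of whose points lie in `E`. -/
def dotProductConfigs {V : Type*} [Fintype V] (G : SimpleGraph V) (w : Sym2 V → ℝ)
    (E : Finset Plane) : Set (Fin (Fintype.card V) → Plane) :=
  {x | (∀ i, x i ∈ E) ∧ IsDotProductConfig G w x}

/-- `g(G; n)`: the maximum number of dot product `G`-configurations in a set of `n` points of
the plane. The supremum is a maximum, see `isGreatest_maxDotProductConfigs`. -/
noncomputable def maxDotProductConfigs {V : Type*} [Fintype V] (G : SimpleGraph V)
    (w : Sym2 V → ℝ) (n : ℕ) : ℕ :=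
  sSup {m : ℕ | ∃ E : Finset Plane, E.card = n ∧ (dotProductConfigs G w E).ncard = m}

theorem dotProductConfigs_subset {V : Type*} [Fintype V] (G : SimpleGraph V) (w : Sym2 V → ℝ)
    (E : Finset Plane) :
    dotProductConfigs G w E ⊆ (Fintype.piFinset fun _ : Fin (Fintype.card V) => E) := by
  intro x hx
  simpa using hx.1

theorem isGreatest_maxDotProductConfigs {V : Type*} [Fintype V] (G : SimpleGraph V)
    (w : Sym2 V → ℝ) (n : ℕ) :
    IsGreatest {m : ℕ | ∃ E : Finset Plane, E.card = n ∧ (dotProductConfigs G w E).ncard = m}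
      (maxDotProductConfigs G w n) := by
  have hne : {m : ℕ | ∃ E : Finset Plane,
      E.card = n ∧ (dotProductConfigs G w E).ncard = m}.Nonempty := by
    obtain ⟨E, hE⟩ := Infinite.exists_subset_card_eq Plane n
    exact ⟨_, E, hE, rfl⟩
  have hbdd : BddAbove {m : ℕ | ∃ E : Finset Plane,
      E.card = n ∧ (dotProductConfigs G w E).ncard = m} := by
    refine ⟨n ^ Fintype.card V, ?_⟩
    rintro m ⟨E, hE, rfl⟩
    have h := Set.ncard_le_ncard (dotProductConfigs_subset G w E) (Finset.finite_toSet _)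
    rw [Set.ncard_coe_finset, Fintype.card_piFinset] at h
    simpa [hE] using h
  exact ⟨Nat.sSup_mem hne hbdd, fun m hm => le_csSup hbdd hm⟩

/-!
The triangle has weights `a`, `b`, `c` on its edges `uv`, `vz`, `uz`.

For the upper bound, fix two points `u`, `v` with `u · v = a`. If they are linearly independent,
then `u · z` and `v · z` determine `z`; otherwise `v = (b / c) u`, so that `u` and `z` determine
`v`. Hence (`card_dotTriples_le`) there are at most as many triples as pairs with dot product `a`
plus pairs with dot product `c`. The pairs with dot product `a ≠ 0` are the incidences between the
given points and the lines `{v | u · v = a}`, which are distinct for distinct `u`. So the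
Szemerédi–Trotter bound `card_incidences_le_rpow` gives `O(n ^ (4 / 3))` (`card_dotPairs_le`).

The Szemerédi–Trotter bound is derived from a crossing inequality for the segments between
consecutive points on the lines. It needs a linear bound for the number of edges of a straight-line
drawing without crossings. Instead of Euler's formula, a charging argument is used
(`card_le_three_mul_of_not_meets`): two edges that are consecutive among those leaving a vertex to
the right span a wedge, and the first vertex in that wedge is charged, at most twice in all. A
random sample of the vertices then turns the linear bound into `crossing_inequality`. After a
generic shear the points have distinct abscissae and no line is vertical, so a point set is encoded
as the graph of a function `y` over a finite set `X` of reals, and a line as its slope and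
intercept.

For the lower bound, a triangle with first vertex `(s, 0)` exists for every large `s`
(`exists_triangle`), and the vertices of `n / 3` such triangles number at most `n`
(`le_maxDotProductConfigs`).
-/

section Incidences

open Finset
open scoped Classical

/-! ### Chords over a finite set of abscissae -/

/-- The height at abscissa `x` of the non-vertical line `ℓ = (m, b)`, that is `y = m x + b`. -/
def lineAt (ℓ : ℝ × ℝ) (x : ℝ) : ℝ := ℓ.1 * x + ℓ.2

/-- The part of a non-vertical line that lies over the interval `[left, right]`. -/
@[ext] structure Chord where
  /-- The supporting line, as a pair (slope, intercept). -/
  line : ℝ × ℝ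
  /-- The abscissa of the left endpoint. -/
  left : ℝ
  /-- The abscissa of the right endpoint. -/
  right : ℝ

/-- The chord `e` joins two points of the finite point set `{(x, y x) | x ∈ X}` and has no point
of that set in its relative interior. -/
structure Chord.Joins (X : Finset ℝ) (y : ℝ → ℝ) (e : Chord) : Prop where
  left_mem : e.left ∈ X
  right_mem : e.right ∈ X
  lt : e.left < e.right
  at_left : lineAt e.line e.left = y e.left
  at_right : lineAt e.line e.right = y e.right
  empty : ∀ c ∈ X, e.left < c → c < e.right → lineAt e.line c ≠ y c

/-- The relative interiors of the two chords have a common point. -/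
def Chord.Meets (e f : Chord) : Prop :=
  ∃ x, e.left < x ∧ x < e.right ∧ f.left < x ∧ x < f.right ∧ lineAt e.line x = lineAt f.line x

theorem line_eq_of_lineAt_eq {ℓ m : ℝ × ℝ} {a b : ℝ} (hab : a ≠ b)
    (ha : lineAt ℓ a = lineAt m a) (hb : lineAt ℓ b = lineAt m b) : ℓ = m := by
  unfold lineAt at ha hb
  have h : (ℓ.1 - m.1) * (a - b) = 0 := by linarith
  have h1 : ℓ.1 - m.1 = 0 := (mul_eq_zero.mp h).resolve_right (sub_ne_zero.mpr hab)
  have h2 : ℓ.1 = m.1 := by linarith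
  refine Prod.ext h2 ?_
  rw [h2] at ha
  linarith

/-- If two lines do not meet over `(a, b)` and one is above the other at `b`, then it is at least
as high at `a`. -/
theorem lineAt_le_of_ne {ℓ m : ℝ × ℝ} {a b : ℝ} (hab : a ≤ b)
    (hne : ∀ x, a < x → x < b → lineAt ℓ x ≠ lineAt m x) (hb : lineAt ℓ b < lineAt m b) :
    lineAt ℓ a ≤ lineAt m a := by
  by_contra! h
  have hc : ContinuousOn (fun x => lineAt ℓ x - lineAt m x) (Set.Icc a b) := by
    unfold lineAt
    fun_prop
  obtain ⟨x, hx, hx0⟩ := intermediate_value_Ioo' hab hc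
    (show (0 : ℝ) ∈ Set.Ioo _ _ from ⟨by linarith, by linarith⟩)
  exact hne x hx.1 hx.2 (sub_eq_zero.mp hx0)

theorem Chord.Joins.mono {X S : Finset ℝ} {y : ℝ → ℝ} {e : Chord} (h : e.Joins X y) (hS : S ⊆ X)
    (hl : e.left ∈ S) (hr : e.right ∈ S) : e.Joins S y :=
  ⟨hl, hr, h.lt, h.at_left, h.at_right, fun c hc => h.empty c (hS hc)⟩

/-- Chords of the same line with a common interior abscissa coincide: otherwise an endpoint of one
would lie inside the other. -/
theorem Chord.Joins.eq_of_line_eq {X : Finset ℝ} {y : ℝ → ℝ} {e f : Chord} (he : e.Joins X y)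
    (hf : f.Joins X y) (hline : e.line = f.line) {x : ℝ} (h1 : e.left < x) (h2 : x < e.right)
    (h3 : f.left < x) (h4 : x < f.right) : e = f := by
  refine Chord.ext hline ?_ ?_
  · rcases lt_trichotomy e.left f.left with h | h | h
    · exact absurd (hline ▸ hf.at_left) (he.empty _ hf.left_mem h (h3.trans h2))
    · exact h
    · exact absurd (hline ▸ he.at_left) (hf.empty _ he.left_mem h (h1.trans h4))
  · rcases lt_trichotomy e.right f.right with h | h | h
    · exact absurd (hline ▸ he.at_right) (hf.empty _ he.right_mem (h3.trans h2) h)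
    · exact h
    · exact absurd (hline ▸ hf.at_right) (he.empty _ hf.right_mem (h1.trans h4) h)

theorem Chord.Joins.eq_of_left_eq {X : Finset ℝ} {y : ℝ → ℝ} {e f : Chord} (he : e.Joins X y)
    (hf : f.Joins X y) (hleft : e.left = f.left) {x : ℝ} (hx : e.left < x)
    (hx1 : x ≤ e.right) (hx2 : x ≤ f.right) (h : lineAt e.line x = lineAt f.line x) : e = f := by
  have hline : e.line = f.line := by
    refine line_eq_of_lineAt_eq hx.ne ?_ h
    rw [he.at_left, hleft, hf.at_left]
  refine he.eq_of_line_eq hf hline (x := (e.left + x) / 2) ?_ ?_ ?_ ?_ <;> linarith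

theorem Chord.Joins.eq_of_right_eq {X : Finset ℝ} {y : ℝ → ℝ} {e f : Chord} (he : e.Joins X y)
    (hf : f.Joins X y) (hright : e.right = f.right) {x : ℝ} (hx : x < e.right)
    (hx1 : e.left ≤ x) (hx2 : f.left ≤ x) (h : lineAt e.line x = lineAt f.line x) : e = f := by
  have hline : e.line = f.line := by
    refine line_eq_of_lineAt_eq hx.ne h ?_
    rw [he.at_right, hright, hf.at_right]
  refine he.eq_of_line_eq hf hline (x := (e.right + x) / 2) ?_ ?_ ?_ ?_ <;> linarith

/-- Chords that meet have four distinct endpoints. -/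
theorem Chord.Meets.card_endpoints {X : Finset ℝ} {y : ℝ → ℝ} {e f : Chord} (he : e.Joins X y)
    (hf : f.Joins X y) (hne : e ≠ f) (h : e.Meets f) :
    ({e.left, e.right, f.left, f.right} : Finset ℝ).card = 4 := by
  obtain ⟨x, h1, h2, h3, h4, h5⟩ := h
  have hll : e.left ≠ f.left := fun h => hne (he.eq_of_left_eq hf h h1 h2.le h4.le h5)
  have hrr : e.right ≠ f.right := fun h => hne (he.eq_of_right_eq hf h h2 h1.le h3.le h5)
  have hlr : e.left ≠ f.right := (h1.trans h4).ne
  have hrl : e.right ≠ f.left := (h3.trans h2).ne'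
  rw [card_insert_of_notMem, card_insert_of_notMem, card_insert_of_notMem, card_singleton]
  · simpa using hf.lt.ne
  · simp [hrl, hrr]
  · simp [he.lt.ne, hll, hlr]

/-! ### Pairwise non-meeting chords -/

/-- `e` and `f` are consecutive among the chords of `A` that leave their common left endpoint to
the right, `e` being the lower one, and `w` is the abscissa of the leftmost point of the point set
that lies between them. -/
structure IsWedge (S : Finset ℝ) (y : ℝ → ℝ) (A : Finset Chord) (e f : Chord) (w : ℝ) :
    Prop where
  lower_mem : e ∈ A
  upper_mem : f ∈ A
  left_eq : e.left = f.left
  slope_lt : e.line.1 < f.line.1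
  consecutive : ∀ g ∈ A, g.left = f.left → e.line.1 < g.line.1 → ¬ g.line.1 < f.line.1
  mem : w ∈ S
  left_lt : f.left < w
  le_lower : w ≤ e.right
  le_upper : w ≤ f.right
  above : lineAt e.line w ≤ y w
  below : y w ≤ lineAt f.line w
  first : ∀ c ∈ S, f.left < c → c < w → lineAt e.line c ≤ y c → ¬ y c ≤ lineAt f.line c

theorem exists_isWedge {S : Finset ℝ} {y : ℝ → ℝ} {A : Finset Chord}
    (hA : ∀ e ∈ A, e.Joins S y) {f : Chord} (hf : f ∈ A)
    (h : ∃ e ∈ A, e.left = f.left ∧ e.line.1 < f.line.1) : ∃ e w, IsWedge S y A e f w := by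
  obtain ⟨e, he, hmax⟩ := exists_max_image
    (A.filter fun e => e.left = f.left ∧ e.line.1 < f.line.1) (fun e => e.line.1)
    (by obtain ⟨e, he, h1⟩ := h; exact ⟨e, by simp [he, h1]⟩)
  simp only [mem_filter] at he hmax
  obtain ⟨he, hl, hs⟩ := he
  have hle : ∀ c, f.left < c → lineAt e.line c < lineAt f.line c := by
    intro c hc
    have h0 : lineAt e.line f.left = lineAt f.line f.left := by
      rw [(hA f hf).at_left, ← hl, (hA e he).at_left]
    unfold lineAt at h0 ⊢
    nlinarith
  let W := S.filter fun c => f.left < c ∧ c ≤ e.right ∧ c ≤ f.right ∧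
    lineAt e.line c ≤ y c ∧ y c ≤ lineAt f.line c
  have hW : W.Nonempty := by
    have hl1 := (hA f hf).lt
    have hl2 : f.left < e.right := hl ▸ (hA e he).lt
    rcases le_total e.right f.right with hr | hr
    · refine ⟨e.right, mem_filter.mpr ⟨(hA e he).right_mem, hl2, le_rfl, hr, ?_, ?_⟩⟩
      · exact (hA e he).at_right.le
      · rw [← (hA e he).at_right]
        exact (hle _ hl2).le
    · refine ⟨f.right, mem_filter.mpr ⟨(hA f hf).right_mem, hl1, hr, le_rfl, ?_, ?_⟩⟩
      · rw [← (hA f hf).at_right]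
        exact (hle _ hl1).le
      · exact (hA f hf).at_right.ge
  obtain ⟨w, hw, hmin⟩ := exists_min_image W id hW
  obtain ⟨hwS, hw1, hw2, hw3, hw4, hw5⟩ := mem_filter.mp hw
  refine ⟨e, w, he, hf, hl, hs, ?_, hwS, hw1, hw2, hw3, hw4, hw5, ?_⟩
  · intro g hg hgl h1 h2
    exact absurd (hmax g ⟨hg, hgl, h2⟩) (not_le.mpr h1)
  · intro c hc h1 h2 h3 h4
    have := hmin c (mem_filter.mpr ⟨hc, h1, by linarith, by linarith, h3, h4⟩)
    exact absurd this (not_le.mpr h2)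

/-- Over `w`, no further chord passes between the two sides of a wedge, except through the point
over `w` itself. Followed to the left, such a chord would have to start inside the wedge, which is
empty to the left of `w`, or at its apex, but the two sides are consecutive there. -/
theorem IsWedge.eq_or_eq {S : Finset ℝ} {y : ℝ → ℝ} {A : Finset Chord}
    (hA : ∀ e ∈ A, e.Joins S y) (hcr : ∀ e ∈ A, ∀ f ∈ A, e ≠ f → ¬ e.Meets f)
    {e f g : Chord} {w : ℝ} (h : IsWedge S y A e f w) (hg : g ∈ A) (hgl : g.left < w)
    (hgr : w ≤ g.right) (h1 : lineAt e.line w ≤ lineAt g.line w)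
    (h2 : lineAt g.line w ≤ lineAt f.line w) (hy : lineAt g.line w ≠ y w) : g = e ∨ g = f := by
  by_contra! hne
  obtain ⟨hge, hgf⟩ := hne
  have hE := hA e h.lower_mem
  have hF := hA f h.upper_mem
  have hG := hA g hg
  have hgr' : w < g.right := lt_of_le_of_ne hgr fun hw => hy (by rw [hw, hG.at_right])
  -- A side of the wedge that agrees with `g` over `w` would meet `g` or end at the point over `w`.
  have hstrict : ∀ k ∈ A, k.Joins S y → g ≠ k → k.left < w → w ≤ k.right →
      lineAt g.line w ≠ lineAt k.line w := by
    intro k hk hK hgk hkl hkr heq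
    rcases hkr.lt_or_eq with hlt | hw
    · exact hcr g hg k hk hgk ⟨w, hgl, hgr', hkl, hlt, heq⟩
    · exact hy (by rw [heq, hw, hK.at_right])
  have hel : e.left < w := h.left_eq ▸ h.left_lt
  have h1' : lineAt e.line w < lineAt g.line w :=
    lt_of_le_of_ne h1 (hstrict e h.lower_mem hE hge hel h.le_lower).symm
  have h2' : lineAt g.line w < lineAt f.line w :=
    lt_of_le_of_ne h2 (hstrict f h.upper_mem hF hgf h.left_lt h.le_upper)
  have hmw : max f.left g.left ≤ w := max_le h.left_lt.le hgl.le
  have hm1 : lineAt e.line (max f.left g.left) ≤ lineAt g.line (max f.left g.left) := by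
    refine lineAt_le_of_ne hmw (fun x hx1 hx2 heq => ?_) h1'
    obtain ⟨hx3, hx4⟩ := max_lt_iff.mp hx1
    exact hcr g hg e h.lower_mem hge
      ⟨x, hx4, hx2.trans hgr', h.left_eq ▸ hx3, hx2.trans_le h.le_lower, heq.symm⟩
  have hm2 : lineAt g.line (max f.left g.left) ≤ lineAt f.line (max f.left g.left) := by
    refine lineAt_le_of_ne hmw (fun x hx1 hx2 heq => ?_) h2'
    obtain ⟨hx3, hx4⟩ := max_lt_iff.mp hx1
    exact hcr g hg f h.upper_mem hgf
      ⟨x, hx4, hx2.trans hgr', hx3, hx2.trans_le h.le_upper, heq⟩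
  rcases lt_or_ge f.left g.left with hlt | hge'
  · rw [max_eq_right hlt.le, hG.at_left] at hm1 hm2
    exact h.first _ hG.left_mem hlt hgl hm1 hm2
  · rw [max_eq_left hge'] at hm1 hm2
    have h0 : lineAt e.line f.left = y f.left := by rw [← h.left_eq, hE.at_left]
    rw [h0] at hm1
    rw [hF.at_left] at hm2
    have hy0 : lineAt g.line f.left = y f.left := le_antisymm hm2 hm1
    rcases hge'.lt_or_eq with hlt | heq
    · exact hG.empty _ hF.left_mem hlt (h.left_lt.trans hgr') hy0
    · have hfl := hF.at_left
      have hlw := h.left_lt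
      unfold lineAt at h0 hy0 h1' h2' hfl
      refine h.consecutive g hg heq ?_ ?_
      · by_contra! hcon
        nlinarith
      · by_contra! hcon
        nlinarith

/-- A straight-line drawing without crossings has at most three times as many edges as vertices.
The chords that are lowest at their left endpoint are counted by that endpoint. Every other chord
`f` is the upper side of a wedge, and is charged to the leftmost point `w` in that wedge. If `w`
lies below `f`, then `f` is the first chord above `w`; otherwise the lower side is the first chord
below `w`, and it determines `f`. So every point is charged at most twice. -/
theorem card_le_three_mul_of_not_meets {S : Finset ℝ} {y : ℝ → ℝ} {A : Finset Chord}
    (hA : ∀ e ∈ A, e.Joins S y) (hcr : ∀ e ∈ A, ∀ f ∈ A, e ≠ f → ¬ e.Meets f) :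
    A.card ≤ 3 * S.card := by
  have hwedge : ∀ f : Chord, ∃ p : Chord × ℝ,
      (f ∈ A ∧ ∃ e ∈ A, e.left = f.left ∧ e.line.1 < f.line.1) → IsWedge S y A p.1 f p.2 := by
    intro f
    by_cases hf : f ∈ A ∧ ∃ e ∈ A, e.left = f.left ∧ e.line.1 < f.line.1
    · obtain ⟨e, w, h⟩ := exists_isWedge hA hf.1 hf.2
      exact ⟨(e, w), fun _ => h⟩
    · exact ⟨(f, 0), fun h => absurd h hf⟩
  choose p hp using hwedge
  let B := A.filter fun f => ∃ e ∈ A, e.left = f.left ∧ e.line.1 < f.line.1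
  have hB : ∀ f ∈ B, IsWedge S y A (p f).1 f (p f).2 := fun f hf => hp f (mem_filter.mp hf)
  have hlow : (A.filter fun f => ¬ ∃ e ∈ A, e.left = f.left ∧ e.line.1 < f.line.1).card
      ≤ S.card := by
    refine card_le_card_of_injOn (fun f => f.left)
      (fun f hf => (hA f (mem_filter.mp hf).1).left_mem) ?_
    intro e he f hf hl
    obtain ⟨heA, he⟩ := mem_filter.mp he
    obtain ⟨hfA, hf⟩ := mem_filter.mp hf
    push Not at he hf
    have hslope : e.line.1 = f.line.1 :=
      le_antisymm (he f hfA hl.symm) (hf e heA hl)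
    have hl' : e.left = f.left := hl
    have h1 := (hA e heA).at_left
    have h2 := (hA f hfA).at_left
    have hx1 := (hA e heA).lt
    have hx2 := (hA f hfA).lt
    refine (hA e heA).eq_of_left_eq (hA f hfA) hl (x := min e.right f.right)
      (lt_min hx1 (hl' ▸ hx2)) (min_le_left _ _) (min_le_right _ _) ?_
    rw [← hl', ← h1] at h2
    unfold lineAt at h2 ⊢
    rw [hslope] at h2 ⊢
    linarith
  have habove : (B.filter fun f => y (p f).2 < lineAt f.line (p f).2).card ≤ S.card := by
    refine card_le_card_of_injOn (fun f => (p f).2)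
      (fun f hf => (hB f (mem_filter.mp hf).1).mem) ?_
    -- The lower of two chords charged to the same point from above is one of the sides.
    have key : ∀ f ∈ B, ∀ g ∈ B, (p f).2 = (p g).2 → y (p g).2 < lineAt g.line (p g).2 →
        lineAt g.line (p g).2 ≤ lineAt f.line (p g).2 → g = f := by
      intro f hf g hg hw hlt hle
      have hF := hB f hf
      have hG := hB g hg
      rw [hw] at hF
      refine (hF.eq_or_eq hA hcr hG.upper_mem hG.left_lt hG.le_upper
        (hF.above.trans hlt.le) hle hlt.ne').resolve_left ?_
      rintro heq
      exact absurd (heq ▸ hF.above) (not_le.mpr hlt)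
    intro f hf g hg hw
    obtain ⟨hf, hf1⟩ := mem_filter.mp hf
    obtain ⟨hg, hg1⟩ := mem_filter.mp hg
    have hw' : (p f).2 = (p g).2 := hw
    rcases le_total (lineAt g.line (p g).2) (lineAt f.line (p g).2) with h | h
    · exact (key f hf g hg hw' hg1 h).symm
    · rw [← hw'] at h
      exact key g hg f hf hw'.symm hf1 h
  have hbelow : (B.filter fun f => ¬ y (p f).2 < lineAt f.line (p f).2).card ≤ S.card := by
    have hon : ∀ f ∈ B, ¬ y (p f).2 < lineAt f.line (p f).2 →
        lineAt (p f).1.line (p f).2 < y (p f).2 ∧ (p f).2 = f.right := by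
      intro f hf hn
      have hF := hB f hf
      have hJ := hA f hF.upper_mem
      have heq : y (p f).2 = lineAt f.line (p f).2 := le_antisymm hF.below (not_lt.mp hn)
      refine ⟨lt_of_le_of_ne hF.above fun h => ?_, ?_⟩
      · have := (hA _ hF.lower_mem).eq_of_left_eq hJ hF.left_eq (hF.left_eq ▸ hF.left_lt)
          hF.le_lower hF.le_upper (h.trans heq)
        exact absurd hF.slope_lt (by rw [this]; exact lt_irrefl _)
      · by_contra hne
        exact hJ.empty _ hF.mem hF.left_lt (lt_of_le_of_ne hF.le_upper hne) heq.symm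
    refine card_le_card_of_injOn (fun f => (p f).2)
      (fun f hf => (hB f (mem_filter.mp hf).1).mem) ?_
    have key : ∀ f ∈ B, ∀ g ∈ B, (p f).2 = (p g).2 →
        lineAt (p g).1.line (p g).2 < y (p g).2 →
        lineAt (p f).1.line (p g).2 ≤ lineAt (p g).1.line (p g).2 → (p g).1 = (p f).1 := by
      intro f hf g hg hw hlt hle
      have hF := hB f hf
      have hG := hB g hg
      rw [hw] at hF
      refine (hF.eq_or_eq hA hcr hG.lower_mem (hG.left_eq ▸ hG.left_lt) hG.le_lower
        hle (hlt.le.trans hF.below) hlt.ne).resolve_right ?_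
      rintro heq
      exact absurd (heq ▸ hF.below) (not_le.mpr hlt)
    intro f hf g hg hw
    obtain ⟨hf, hf1⟩ := mem_filter.mp hf
    obtain ⟨hg, hg1⟩ := mem_filter.mp hg
    obtain ⟨hf2, hf3⟩ := hon f hf hf1
    obtain ⟨hg2, hg3⟩ := hon g hg hg1
    have hw' : (p f).2 = (p g).2 := hw
    have hpe : (p f).1 = (p g).1 := by
      rcases le_total (lineAt (p f).1.line (p g).2) (lineAt (p g).1.line (p g).2) with h | h
      · exact (key f hf g hg hw' hg2 h).symm
      · rw [← hw'] at h
        exact key g hg f hf hw'.symm hf2 h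
    have hl : f.left = g.left := by
      rw [← (hB f hf).left_eq, ← (hB g hg).left_eq, hpe]
    have hr : f.right = g.right := by rw [← hf3, ← hg3, hw']
    have hJf := hA f (hB f hf).upper_mem
    have hJg := hA g (hB g hg).upper_mem
    refine hJf.eq_of_left_eq hJg hl hJf.lt le_rfl hr.le ?_
    rw [hJf.at_right, hr, hJg.at_right]
  have e1 := card_filter_add_card_filter_not (s := A)
    (fun f => ∃ e ∈ A, e.left = f.left ∧ e.line.1 < f.line.1)
  have e2 := card_filter_add_card_filter_not (s := B)
    (fun f => y (p f).2 < lineAt f.line (p f).2)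
  have e3 : B.card = (A.filter fun f => ∃ e ∈ A, e.left = f.left ∧ e.line.1 < f.line.1).card := rfl
  omega

/-! ### The crossing inequality -/

/-- The ordered pairs of distinct chords of `A` that meet. -/
noncomputable def meetingPairs (A : Finset Chord) : Finset (Chord × Chord) :=
  (A ×ˢ A).filter fun p => p.1 ≠ p.2 ∧ p.1.Meets p.2

theorem card_le_three_mul_add_card_meetingPairs {S : Finset ℝ} {y : ℝ → ℝ} {A : Finset Chord}
    (hA : ∀ e ∈ A, e.Joins S y) : A.card ≤ 3 * S.card + (meetingPairs A).card := by
  have h1 : (A.filter fun e => ¬ ∃ f ∈ A, e ≠ f ∧ e.Meets f).card ≤ 3 * S.card := by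
    refine card_le_three_mul_of_not_meets (y := y) (fun e he => hA e (mem_filter.mp he).1) ?_
    intro e he f hf hne hm
    exact (mem_filter.mp he).2 ⟨f, (mem_filter.mp hf).1, hne, hm⟩
  have h2 : (A.filter fun e => ∃ f ∈ A, e ≠ f ∧ e.Meets f).card ≤ (meetingPairs A).card := by
    refine (card_le_card ?_).trans (card_image_le (f := Prod.fst))
    intro e he
    obtain ⟨he, f, hf, hm⟩ := mem_filter.mp he
    exact mem_image.mpr ⟨(e, f), mem_filter.mpr ⟨mem_product.mpr ⟨he, hf⟩, hm⟩, rfl⟩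
  have h3 := card_filter_add_card_filter_not (s := A) (fun e => ∃ f ∈ A, e ≠ f ∧ e.Meets f)
  omega

/-- If every element of `X` is selected independently with probability `p`, all elements of `T`
are selected with probability `p ^ #T`. -/
theorem sum_powerset_weight {α : Type*} (X T : Finset α) (hT : T ⊆ X) (p : ℝ) :
    ∑ S ∈ X.powerset with T ⊆ S, p ^ S.card * (1 - p) ^ (X \ S).card = p ^ T.card := by
  have h := prod_add (fun _ : α => p) (fun x => if x ∈ T then 0 else 1 - p) X
  have hl : ∏ x ∈ X, (p + if x ∈ T then 0 else 1 - p) = p ^ T.card := by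
    rw [← prod_subset hT (f := fun x => p + if x ∈ T then 0 else 1 - p)]
    · rw [prod_congr rfl (g := fun _ => p) (fun x hx => by simp [hx]), prod_const]
    · intro x _ hx
      simp [hx]
  rw [← hl, h, sum_filter]
  refine sum_congr rfl fun S hS => ?_
  rw [prod_const]
  split_ifs with hTS
  · congr 1
    rw [← prod_const]
    refine prod_congr rfl fun x hx => ?_
    rw [if_neg fun hxT => (mem_sdiff.mp hx).2 (hTS hxT)]
  · obtain ⟨x, hxT, hxS⟩ := not_subset.mp hTS
    rw [prod_eq_zero (i := x) (mem_sdiff.mpr ⟨hT hxT, hxS⟩) (by simp [hxT]), mul_zero]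

theorem sum_powerset_weight_mul_card {α β : Type*} (X : Finset α) (A : Finset β)
    (T : β → Finset α) (k : ℕ) (hT : ∀ a ∈ A, T a ⊆ X) (hk : ∀ a ∈ A, (T a).card = k) (p : ℝ) :
    ∑ S ∈ X.powerset, p ^ S.card * (1 - p) ^ (X \ S).card * ((A.filter fun a => T a ⊆ S).card : ℝ)
      = A.card * p ^ k := by
  have h1 : ∀ S ∈ X.powerset, p ^ S.card * (1 - p) ^ (X \ S).card *
      ((A.filter fun a => T a ⊆ S).card : ℝ) =
      ∑ a ∈ A, if T a ⊆ S then p ^ S.card * (1 - p) ^ (X \ S).card else 0 := by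
    intro S _
    rw [← sum_filter, sum_const, nsmul_eq_mul, mul_comm]
  rw [sum_congr rfl h1, sum_comm, ← nsmul_eq_mul, ← sum_const]
  refine sum_congr rfl fun a ha => ?_
  rw [← sum_filter, sum_powerset_weight X (T a) (hT a ha), hk a ha]

/-- The crossing inequality, from the expectations of both sides of
`card_le_three_mul_add_card_meetingPairs` for a random set of vertices: a vertex survives with
probability `p`, a chord with probability `p ^ 2` and a meeting pair with probability `p ^ 4`. -/
theorem crossing_inequality {X : Finset ℝ} {y : ℝ → ℝ} {A : Finset Chord}
    (hA : ∀ e ∈ A, e.Joins X y) {p : ℝ} (hp0 : 0 ≤ p) (hp1 : p ≤ 1) :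
    (A.card : ℝ) * p ^ 2 ≤ 3 * (X.card * p) + (meetingPairs A).card * p ^ 4 := by
  have hmem : ∀ q ∈ meetingPairs A, q.1 ∈ A ∧ q.2 ∈ A ∧ q.1 ≠ q.2 ∧ q.1.Meets q.2 := by
    intro q hq
    obtain ⟨h1, h2⟩ := mem_filter.mp hq
    exact ⟨(mem_product.mp h1).1, (mem_product.mp h1).2, h2⟩
  have hedge := sum_powerset_weight_mul_card X A (fun e => {e.left, e.right}) 2
    (fun e he => by
      simp [insert_subset_iff, (hA e he).left_mem, (hA e he).right_mem])
    (fun e he => card_pair (hA e he).lt.ne) p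
  have hvert := sum_powerset_weight_mul_card X X (fun x => {x}) 1
    (fun x hx => by simpa using hx) (fun x _ => card_singleton x) p
  have hcross := sum_powerset_weight_mul_card X (meetingPairs A)
    (fun q => {q.1.left, q.1.right, q.2.left, q.2.right}) 4
    (fun q hq => by
      obtain ⟨h1, h2, -⟩ := hmem q hq
      simp [insert_subset_iff, (hA _ h1).left_mem, (hA _ h1).right_mem, (hA _ h2).left_mem,
        (hA _ h2).right_mem])
    (fun q hq => by
      obtain ⟨h1, h2, h3, h4⟩ := hmem q hq
      exact h4.card_endpoints (hA _ h1) (hA _ h2) h3) p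
  rw [← hedge, ← hcross]
  rw [pow_one] at hvert
  rw [← hvert, mul_sum, ← sum_add_distrib]
  refine sum_le_sum fun S hS => ?_
  have hSX := mem_powerset.mp hS
  have hw : 0 ≤ p ^ S.card * (1 - p) ^ (X \ S).card :=
    mul_nonneg (pow_nonneg hp0 _) (pow_nonneg (by linarith) _)
  have hsub := card_le_three_mul_add_card_meetingPairs (S := S) (y := y)
    (A := A.filter fun e => ({e.left, e.right} : Finset ℝ) ⊆ S) (by
      intro e he
      obtain ⟨he, hes⟩ := mem_filter.mp he
      rw [insert_subset_iff, singleton_subset_iff] at hes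
      exact (hA e he).mono hSX hes.1 hes.2)
  have hv : (X.filter fun x => ({x} : Finset ℝ) ⊆ S) = S := by
    ext x
    simp only [mem_filter, singleton_subset_iff]
    exact ⟨fun h => h.2, fun h => ⟨hSX h, h⟩⟩
  have hc : meetingPairs (A.filter fun e => ({e.left, e.right} : Finset ℝ) ⊆ S) ⊆
      (meetingPairs A).filter fun q =>
        ({q.1.left, q.1.right, q.2.left, q.2.right} : Finset ℝ) ⊆ S := by
    intro q hq
    simp only [meetingPairs, mem_filter, mem_product, insert_subset_iff,
      singleton_subset_iff] at hq ⊢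
    tauto
  have hle : ((A.filter fun e => ({e.left, e.right} : Finset ℝ) ⊆ S).card : ℝ) ≤
      3 * S.card + (((meetingPairs A).filter fun q =>
        ({q.1.left, q.1.right, q.2.left, q.2.right} : Finset ℝ) ⊆ S).card : ℝ) := by
    exact_mod_cast hsub.trans (Nat.add_le_add_left (card_le_card hc) _)
  rw [hv]
  nlinarith [mul_le_mul_of_nonneg_left hle hw]

/-! ### The incidence bound -/

/-- The incidences between the lines of `L` and the points `(x, y x)`, `x ∈ X`. -/
noncomputable def incidences (X : Finset ℝ) (y : ℝ → ℝ) (L : Finset (ℝ × ℝ)) :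
    Finset ((ℝ × ℝ) × ℝ) :=
  (L ×ˢ X).filter fun i => lineAt i.1 i.2 = y i.2

/-- The chords that join consecutive points `(x, y x)`, `x ∈ X`, on the lines of `L`. -/
noncomputable def chords (X : Finset ℝ) (y : ℝ → ℝ) (L : Finset (ℝ × ℝ)) : Finset Chord :=
  ((L ×ˢ X ×ˢ X).image fun t => ⟨t.1, t.2.1, t.2.2⟩).filter fun e => e.Joins X y

theorem mem_chords {X : Finset ℝ} {y : ℝ → ℝ} {L : Finset (ℝ × ℝ)} {e : Chord} :
    e ∈ chords X y L ↔ e.line ∈ L ∧ e.Joins X y := by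
  simp only [chords, mem_filter, mem_image, mem_product]
  constructor
  · rintro ⟨⟨t, ⟨h1, -, -⟩, rfl⟩, h⟩
    exact ⟨h1, h⟩
  · rintro ⟨h1, h⟩
    exact ⟨⟨(e.line, e.left, e.right), ⟨h1, h.left_mem, h.right_mem⟩, rfl⟩, h⟩

/-- On each line every incident point but the last one is the left endpoint of a chord. -/
theorem card_incidences_le (X : Finset ℝ) (y : ℝ → ℝ) (L : Finset (ℝ × ℝ)) :
    (incidences X y L).card ≤ (chords X y L).card + L.card := by
  let I := incidences X y L
  have hI : ∀ {i}, i ∈ I ↔ (i.1 ∈ L ∧ i.2 ∈ X) ∧ lineAt i.1 i.2 = y i.2 := by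
    intro i
    simp [I, incidences]
  have h1 : (I.filter fun i => ∃ b ∈ X, i.2 < b ∧ lineAt i.1 b = y b).card ≤
      (chords X y L).card := by
    refine (card_le_card ?_).trans (card_image_le (f := fun e : Chord => (e.line, e.left)))
    intro i hi
    obtain ⟨hi, b, hb⟩ := mem_filter.mp hi
    obtain ⟨⟨hiL, hiX⟩, hiy⟩ := hI.mp hi
    obtain ⟨c, hc, hmin⟩ := exists_min_image
      (X.filter fun b => i.2 < b ∧ lineAt i.1 b = y b) id ⟨b, mem_filter.mpr hb⟩
    obtain ⟨hcX, hc1, hc2⟩ := mem_filter.mp hc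
    refine mem_image.mpr ⟨⟨i.1, i.2, c⟩, mem_chords.mpr ⟨hiL, hiX, hcX, hc1, hiy, hc2, ?_⟩, rfl⟩
    intro d hd hd1 hd2 hd3
    exact absurd (hmin d (mem_filter.mpr ⟨hd, hd1, hd3⟩)) (not_le.mpr hd2)
  have h2 : (I.filter fun i => ¬ ∃ b ∈ X, i.2 < b ∧ lineAt i.1 b = y b).card ≤ L.card := by
    refine card_le_card_of_injOn Prod.fst
      (fun i hi => (hI.mp (mem_filter.mp hi).1).1.1) ?_
    intro i hi j hj hij
    obtain ⟨hi, hi1⟩ := mem_filter.mp hi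
    obtain ⟨hj, hj1⟩ := mem_filter.mp hj
    obtain ⟨⟨-, hiX⟩, hiy⟩ := hI.mp hi
    obtain ⟨⟨-, hjX⟩, hjy⟩ := hI.mp hj
    have hij' : i.1 = j.1 := hij
    refine Prod.ext hij ?_
    rcases lt_trichotomy i.2 j.2 with h | h | h
    · exact absurd ⟨j.2, hjX, h, hij' ▸ hjy⟩ hi1
    · exact h
    · exact absurd ⟨i.2, hiX, h, hij' ▸ hiy⟩ hj1
  have h3 := card_filter_add_card_filter_not (s := I)
    (fun i => ∃ b ∈ X, i.2 < b ∧ lineAt i.1 b = y b)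
  change I.card ≤ _
  omega

/-- A meeting pair of chords is determined by the two lines, which have only one common point. -/
theorem card_meetingPairs_chords_le (X : Finset ℝ) (y : ℝ → ℝ) (L : Finset (ℝ × ℝ)) :
    (meetingPairs (chords X y L)).card ≤ L.card ^ 2 := by
  rw [sq, ← card_product]
  have hmem : ∀ q ∈ meetingPairs (chords X y L), (q.1.line ∈ L ∧ q.1.Joins X y) ∧
      (q.2.line ∈ L ∧ q.2.Joins X y) ∧ q.1 ≠ q.2 ∧ q.1.Meets q.2 := by
    intro q hq
    obtain ⟨h1, h2⟩ := mem_filter.mp hq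
    obtain ⟨h3, h4⟩ := mem_product.mp h1
    exact ⟨mem_chords.mp h3, mem_chords.mp h4, h2⟩
  refine card_le_card_of_injOn (fun q => (q.1.line, q.2.line)) ?_ ?_
  · intro q hq
    obtain ⟨h1, h2, -⟩ := hmem q hq
    exact mem_product.mpr ⟨h1.1, h2.1⟩
  · intro q hq r hr hqr
    obtain ⟨⟨-, hq1⟩, ⟨-, hq2⟩, hqne, x, hx1, hx2, hx3, hx4, hx5⟩ := hmem q hq
    obtain ⟨⟨-, hr1⟩, ⟨-, hr2⟩, -, z, hz1, hz2, hz3, hz4, hz5⟩ := hmem r hr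
    obtain ⟨hl1, hl2⟩ := Prod.ext_iff.mp hqr
    simp only at hl1 hl2
    have hxz : x = z := by
      by_contra hne
      refine hqne (hq1.eq_of_line_eq hq2 (line_eq_of_lineAt_eq hne hx5 ?_) hx1 hx2 hx3 hx4)
      rw [hl1, hl2, hz5]
    subst hxz
    exact Prod.ext (hq1.eq_of_line_eq hr1 hl1 hx1 hx2 hz1 hz2)
      (hq2.eq_of_line_eq hr2 hl2 hx3 hx4 hz3 hz4)

/-- The Szemerédi–Trotter bound for at most `n` points with distinct abscissae and at most `n`
non-vertical lines. -/
theorem card_incidences_le_rpow {X : Finset ℝ} (y : ℝ → ℝ) {L : Finset (ℝ × ℝ)} {n : ℕ}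
    (hn : 0 < n) (hX : X.card ≤ n) (hL : L.card ≤ n) :
    ((incidences X y L).card : ℝ) ≤ 5 * (n : ℝ) ^ ((4 : ℝ) / 3) := by
  -- The sampling probability `n ^ (-1/3)` balances the two terms of the crossing inequality.
  set s : ℝ := (n : ℝ) ^ ((1 : ℝ) / 3) with hs
  have hn0 : (0 : ℝ) ≤ n := Nat.cast_nonneg n
  have hn1 : (1 : ℝ) ≤ n := by exact_mod_cast hn
  have hs1 : 1 ≤ s := Real.one_le_rpow hn1 (by norm_num)
  have hs0 : 0 < s := by linarith
  have hs3 : s ^ 3 = n := by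
    rw [hs, ← Real.rpow_natCast, ← Real.rpow_mul hn0]
    norm_num
  have hs4 : (n : ℝ) ^ ((4 : ℝ) / 3) = s ^ 4 := by
    rw [hs, ← Real.rpow_natCast, ← Real.rpow_mul hn0]
    norm_num
  have hcr := crossing_inequality (A := chords X y L) (fun e he => (mem_chords.mp he).2)
    (p := s⁻¹) (by positivity) (inv_le_one_of_one_le₀ hs1)
  have hm : ((meetingPairs (chords X y L)).card : ℝ) ≤ (s ^ 3) ^ 2 := by
    rw [hs3]
    exact_mod_cast (card_meetingPairs_chords_le X y L).trans (Nat.pow_le_pow_left hL 2)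
  have hX' : (X.card : ℝ) ≤ s ^ 3 := by rw [hs3]; exact_mod_cast hX
  have hL' : (L.card : ℝ) ≤ s ^ 3 := by rw [hs3]; exact_mod_cast hL
  have hI : ((incidences X y L).card : ℝ) ≤ (chords X y L).card + L.card := by
    exact_mod_cast card_incidences_le X y L
  have hch : ((chords X y L).card : ℝ) ≤ 4 * s ^ 4 := by
    have h1 : (X.card : ℝ) * s⁻¹ ≤ s ^ 2 := by
      rw [← div_eq_mul_inv, div_le_iff₀ hs0]
      linarith
    have h2 : ((meetingPairs (chords X y L)).card : ℝ) * s⁻¹ ^ 4 ≤ s ^ 2 := by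
      rw [inv_pow, ← div_eq_mul_inv, div_le_iff₀ (by positivity)]
      linarith
    have h3 : ((chords X y L).card : ℝ) * s⁻¹ ^ 2 ≤ 4 * s ^ 2 := by linarith
    rw [inv_pow, ← div_eq_mul_inv, div_le_iff₀ (by positivity)] at h3
    linarith
  rw [hs4]
  have : s ^ 3 ≤ s ^ 4 := pow_le_pow_right₀ hs1 (by norm_num)
  linarith

end Incidences

section DotProducts

open Finset
open scoped Classical

/-! ### Pairs and triples with prescribed dot products -/

theorem inner_plane (u v : Plane) : inner ℝ u v = u 0 * v 0 + u 1 * v 1 := by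
  simp [PiLp.inner_apply, Fin.sum_univ_two, mul_comm]

theorem plane_ext {u v : Plane} (h0 : u 0 = v 0) (h1 : u 1 = v 1) : u = v := by
  ext i
  fin_cases i
  · exact h0
  · exact h1

/-- The ordered pairs of points of `E` with dot product `a`. -/
noncomputable def dotPairs (E : Finset Plane) (a : ℝ) : Finset (Plane × Plane) :=
  (E ×ˢ E).filter fun p => inner ℝ p.1 p.2 = a

/-- A shear `(p₀, p₁) ↦ (p₀ + t p₁, p₁)` that gives the points of `E` distinct abscissae and makes
no line `{v | u · v = a}`, `0 ≠ u ∈ E`, vertical. -/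
theorem exists_generic_shear (E : Finset Plane) : ∃ t : ℝ,
    Set.InjOn (fun p : Plane => p 0 + t * p 1) E ∧ ∀ u ∈ E, u ≠ 0 → u 1 - t * u 0 ≠ 0 := by
  obtain ⟨t, ht⟩ := Infinite.exists_notMem_finset
    ((E ×ˢ E).image (fun p => (p.2 0 - p.1 0) / (p.1 1 - p.2 1)) ∪ E.image fun u => u 1 / u 0)
  simp only [mem_union, mem_image, mem_product, not_or, not_exists, not_and] at ht
  refine ⟨t, fun u hu v hv h => ?_, fun u hu hu0 h => ?_⟩
  · simp only at h
    have h1 : u 1 = v 1 := by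
      by_contra hne
      refine ht.1 (u, v) ⟨hu, hv⟩ ?_
      rw [div_eq_iff (sub_ne_zero.mpr hne)]
      linarith
    exact plane_ext (by rw [h1] at h; linarith) h1
  · have h0 : u 0 = 0 := by
      by_contra hne
      refine ht.2 u hu ?_
      rw [div_eq_iff hne]
      linarith
    exact hu0 (plane_ext (by simpa using h0) (by simpa [h0] using h))

/-- As `a ≠ 0`, distinct points `u ≠ 0` have distinct lines `{v | u · v = a}`, so that the pairs
with dot product `a` are the incidences between `n` points and at most `n` lines. -/
theorem card_dotPairs_le {E : Finset Plane} {n : ℕ} (hn : 0 < n) (hE : E.card = n) {a : ℝ}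
    (ha : a ≠ 0) : ((dotPairs E a).card : ℝ) ≤ 5 * (n : ℝ) ^ ((4 : ℝ) / 3) := by
  obtain ⟨t, hinj, hvert⟩ := exists_generic_shear E
  let f : Plane → ℝ := fun p => p 0 + t * p 1
  let g : Plane → ℝ × ℝ := fun u => (-u 0 / (u 1 - t * u 0), a / (u 1 - t * u 0))
  let y : ℝ → ℝ := fun x => Function.invFunOn f E x 1
  have hy : ∀ v ∈ E, y (f v) = v 1 := fun v hv => by
    simp only [y]
    rw [hinj.leftInvOn_invFunOn hv]
  have hmem : ∀ p ∈ dotPairs E a, p.1 ∈ E ∧ p.2 ∈ E ∧ p.1 1 - t * p.1 0 ≠ 0 ∧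
      p.1 0 * p.2 0 + p.1 1 * p.2 1 = a := by
    intro p hp
    obtain ⟨h1, h2⟩ := mem_filter.mp hp
    obtain ⟨h3, h4⟩ := mem_product.mp h1
    refine ⟨h3, h4, hvert _ h3 fun h0 => ha ?_, inner_plane p.1 p.2 ▸ h2⟩
    rw [← h2, h0, inner_zero_left]
  have hle : (dotPairs E a).card ≤ (incidences (E.image f) y (E.image g)).card := by
    refine card_le_card_of_injOn (fun p => (g p.1, f p.2)) ?_ ?_
    · intro p hp
      obtain ⟨h1, h2, h3, h4⟩ := hmem p hp
      refine mem_filter.mpr ⟨mem_product.mpr ⟨mem_image_of_mem g h1, mem_image_of_mem f h2⟩, ?_⟩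
      simp only [lineAt, hy _ h2, g, f]
      rw [div_mul_eq_mul_div, ← add_div, div_eq_iff h3, ← h4]
      ring
    · intro p hp q hq hpq
      obtain ⟨h1, h2, h3, h4⟩ := hmem p hp
      obtain ⟨h1', h2', h3', h4'⟩ := hmem q hq
      simp only [Prod.mk.injEq, g] at hpq
      obtain ⟨⟨hs, hi⟩, hf⟩ := hpq
      have hd : p.1 1 - t * p.1 0 = q.1 1 - t * q.1 0 := by
        rw [div_eq_div_iff h3 h3'] at hi
        exact (mul_left_cancel₀ ha hi).symm
      rw [hd, div_left_inj' h3', neg_inj] at hs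
      exact Prod.ext (plane_ext hs (by rw [hs] at hd; linarith)) (hinj h2 h2' hf)
  have := card_incidences_le_rpow (X := E.image f) y (L := E.image g) hn
    (card_image_le.trans hE.le) (card_image_le.trans hE.le)
  exact (Nat.cast_le.mpr hle).trans this

/-- The ordered triples `(u, v, z)` of points of `E` with `u · v = a`, `v · z = b`, `u · z = c`. -/
noncomputable def dotTriples (E : Finset Plane) (a b c : ℝ) : Finset (Plane × Plane × Plane) :=
  (E ×ˢ E ×ˢ E).filter fun q =>
    inner ℝ q.1 q.2.1 = a ∧ inner ℝ q.2.1 q.2.2 = b ∧ inner ℝ q.1 q.2.2 = c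

/-- If `u` and `v` are linearly independent, then `z` is determined by `u · z` and `v · z`. If they
are not, then `v = (b / c) u`, so that the triple is determined by `u` and `z`. -/
theorem card_dotTriples_le (E : Finset Plane) (a : ℝ) {b c : ℝ} (hc : c ≠ 0) :
    (dotTriples E a b c).card ≤ (dotPairs E a).card + (dotPairs E c).card := by
  have hmem : ∀ q ∈ dotTriples E a b c, q.1 ∈ E ∧ q.2.1 ∈ E ∧ q.2.2 ∈ E ∧
      inner ℝ q.1 q.2.1 = a ∧ q.2.1 0 * q.2.2 0 + q.2.1 1 * q.2.2 1 = b ∧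
      q.1 0 * q.2.2 0 + q.1 1 * q.2.2 1 = c := by
    intro q hq
    simpa only [dotTriples, mem_filter, mem_product, inner_plane, and_assoc] using hq
  have h1 : ((dotTriples E a b c).filter fun q => q.1 0 * q.2.1 1 - q.1 1 * q.2.1 0 ≠ 0).card ≤
      (dotPairs E a).card := by
    refine card_le_card_of_injOn (fun q => (q.1, q.2.1)) ?_ ?_
    · intro q hq
      obtain ⟨h1, h2, -, h3, -⟩ := hmem q (mem_filter.mp hq).1
      exact mem_filter.mpr ⟨mem_product.mpr ⟨h1, h2⟩, h3⟩
    · rintro ⟨u, v, z⟩ hq ⟨u', v', z'⟩ hr hqr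
      obtain ⟨hq, hdet⟩ := mem_filter.mp hq
      obtain ⟨-, -, -, -, h1, h2⟩ := hmem _ hq
      obtain ⟨-, -, -, -, h3, h4⟩ := hmem _ (mem_filter.mp hr).1
      simp only [Prod.mk.injEq] at hqr
      obtain ⟨rfl, rfl⟩ := hqr
      simp only at h1 h2 h3 h4 hdet
      have hz : z = z' := by
        refine plane_ext (mul_left_cancel₀ hdet ?_) (mul_left_cancel₀ hdet ?_)
        · linear_combination v 1 * (h2 - h4) - u 1 * (h1 - h3)
        · linear_combination u 0 * (h1 - h3) - v 0 * (h2 - h4)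
      rw [hz]
  have h2 : ((dotTriples E a b c).filter fun q => ¬ (q.1 0 * q.2.1 1 - q.1 1 * q.2.1 0 ≠ 0)).card ≤
      (dotPairs E c).card := by
    have hpar : ∀ q ∈ dotTriples E a b c, q.1 0 * q.2.1 1 - q.1 1 * q.2.1 0 = 0 →
        c * q.2.1 0 = b * q.1 0 ∧ c * q.2.1 1 = b * q.1 1 := by
      intro q hq hdet
      obtain ⟨-, -, -, -, h1, h2⟩ := hmem q hq
      constructor
      · linear_combination q.1 0 * h1 - q.2.1 0 * h2 - q.2.2 1 * hdet
      · linear_combination q.1 1 * h1 - q.2.1 1 * h2 + q.2.2 0 * hdet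
    refine card_le_card_of_injOn (fun q => (q.1, q.2.2)) ?_ ?_
    · intro q hq
      obtain ⟨h1, -, h2, -, -, h3⟩ := hmem q (mem_filter.mp hq).1
      exact mem_filter.mpr ⟨mem_product.mpr ⟨h1, h2⟩, by rw [inner_plane]; exact h3⟩
    · rintro ⟨u, v, z⟩ hq ⟨u', v', z'⟩ hr hqr
      obtain ⟨hq, hdq⟩ := mem_filter.mp hq
      obtain ⟨hr, hdr⟩ := mem_filter.mp hr
      obtain ⟨h1, h2⟩ := hpar _ hq (not_not.mp hdq)
      obtain ⟨h3, h4⟩ := hpar _ hr (not_not.mp hdr)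
      simp only [Prod.mk.injEq] at hqr
      obtain ⟨rfl, rfl⟩ := hqr
      have hv : v = v' := plane_ext (mul_left_cancel₀ hc (h1.trans h3.symm))
        (mul_left_cancel₀ hc (h2.trans h4.symm))
      rw [hv]
  have h3 := card_filter_add_card_filter_not (s := dotTriples E a b c)
    (fun q => q.1 0 * q.2.1 1 - q.1 1 * q.2.1 0 ≠ 0)
  omega

/-! ### Configurations of the weighted triangle -/

theorem cycleGraph_three_adj {u v : Fin 3} : (SimpleGraph.cycleGraph 3).Adj u v ↔ u ≠ v := by
  rw [SimpleGraph.cycleGraph_three_eq_top, SimpleGraph.top_adj]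

theorem isDotProductConfig_cycleGraph_three_iff {w : Sym2 (Fin 3) → ℝ}
    {x : Fin (Fintype.card (Fin 3)) → Plane} :
    IsDotProductConfig (SimpleGraph.cycleGraph 3) w x ↔ Function.Injective x ∧
      ∃ φ : Fin 3 ≃ Fin (Fintype.card (Fin 3)),
        inner ℝ (x (φ 0)) (x (φ 1)) = w s(0, 1) ∧ inner ℝ (x (φ 1)) (x (φ 2)) = w s(1, 2) ∧
          inner ℝ (x (φ 0)) (x (φ 2)) = w s(0, 2) := by
  refine and_congr_right fun _ => exists_congr fun φ =>
    ⟨fun h => ?_, fun ⟨h1, h2, h3⟩ u v huv => ?_⟩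
  · exact ⟨h 0 1 (cycleGraph_three_adj.mpr (by decide)),
      h 1 2 (cycleGraph_three_adj.mpr (by decide)), h 0 2 (cycleGraph_three_adj.mpr (by decide))⟩
  · have hne := cycleGraph_three_adj.mp huv
    -- Both sides are symmetric in `u` and `v`, so that the ordered case suffices.
    have key : ∀ u v : Fin 3, u < v → inner ℝ (x (φ u)) (x (φ v)) = w s(u, v) := by
      intro u v hlt
      fin_cases u <;> fin_cases v <;> first | exact absurd hlt (by decide) | assumption
    rcases lt_or_gt_of_ne hne with hlt | hlt
    · exact key u v hlt
    · rw [real_inner_comm, Sym2.eq_swap]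
      exact key v u hlt

theorem ncard_dotProductConfigs_le (w : Sym2 (Fin 3) → ℝ) (E : Finset Plane) :
    (dotProductConfigs (SimpleGraph.cycleGraph 3) w E).ncard ≤
      6 * (dotTriples E (w s(0, 1)) (w s(1, 2)) (w s(0, 2))).card := by
  let T := dotTriples E (w s(0, 1)) (w s(1, 2)) (w s(0, 2))
  let K : Finset (Fin (Fintype.card (Fin 3)) → Plane) :=
    ((univ : Finset (Fin 3 ≃ Fin (Fintype.card (Fin 3)))) ×ˢ T).image
      fun r i => ![r.2.1, r.2.2.1, r.2.2.2] (r.1.symm i)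
  have hsub : dotProductConfigs (SimpleGraph.cycleGraph 3) w E ⊆ K := by
    rintro x ⟨hxE, hx⟩
    obtain ⟨-, φ, h1, h2, h3⟩ := isDotProductConfig_cycleGraph_three_iff.mp hx
    refine mem_coe.mpr (mem_image.mpr ⟨(φ, x (φ 0), x (φ 1), x (φ 2)), ?_, ?_⟩)
    · simp [T, dotTriples, hxE, h1, h2, h3]
    · funext i
      obtain ⟨j, rfl⟩ := φ.surjective i
      rw [Equiv.symm_apply_apply]
      fin_cases j <;> rfl
  refine (Set.ncard_le_ncard hsub (finite_toSet K)).trans ?_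
  rw [Set.ncard_coe_finset]
  refine card_image_le.trans_eq ?_
  rw [card_product, card_univ, Fintype.card_equiv (finCongr (Fintype.card_fin 3).symm)]
  rfl

/-- The points `y` and `z` are the ones with the first coordinates that `x · y = a` and `x · z = c`
force, and with second coordinates whose product is `b - a c / s ^ 2`. -/
theorem exists_triangle (a b c : ℝ) {s : ℝ} (hs : s ≠ 0) (hb : b ≠ a * c / s ^ 2) :
    ∃ y z : Plane, !₂[s, 0] ≠ y ∧ !₂[s, 0] ≠ z ∧ y ≠ z ∧ inner ℝ !₂[s, 0] y = a ∧
      inner ℝ y z = b ∧ inner ℝ !₂[s, 0] z = c := by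
  set d := b - a * c / s ^ 2 with hd
  have hd0 : d ≠ 0 := sub_ne_zero.mpr hb
  -- Any `p ≠ 0` with `p ^ 2 ≠ d` keeps `y` and `z` off the axis and apart.
  have hp : 0 < |d| + 1 := by positivity
  have hp2 : d < (|d| + 1) * (|d| + 1) := by
    nlinarith [le_abs_self d, abs_nonneg d]
  refine ⟨!₂[a / s, |d| + 1], !₂[c / s, d / (|d| + 1)], fun h => ?_, fun h => ?_, fun h => ?_,
    ?_, ?_, ?_⟩
  · have h1 : (0 : ℝ) = |d| + 1 := congrArg (fun v : Plane => v 1) h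
    linarith
  · have h1 : (0 : ℝ) = d / (|d| + 1) := congrArg (fun v : Plane => v 1) h
    exact div_ne_zero hd0 hp.ne' h1.symm
  · have h1 : |d| + 1 = d / (|d| + 1) := congrArg (fun v : Plane => v 1) h
    rw [eq_div_iff hp.ne'] at h1
    linarith
  · rw [inner_plane]
    simp
    field_simp
  · rw [inner_plane]
    simp
    field_simp
    rw [hd]
    field_simp
    ring
  · rw [inner_plane]
    simp
    field_simp

theorem le_maxDotProductConfigs (w : Sym2 (Fin 3) → ℝ) (hw : w s(1, 2) ≠ 0) {n k : ℕ}
    (hk : 3 * k ≤ n) : k ≤ maxDotProductConfigs (SimpleGraph.cycleGraph 3) w n := by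
  -- All large `s` satisfy the condition of `exists_triangle`, because `b ≠ 0`.
  obtain ⟨N, hN⟩ : ∃ N : ℕ, ∀ s : ℝ, N < s →
      s ≠ 0 ∧ w s(1, 2) ≠ w s(0, 1) * w s(0, 2) / s ^ 2 := by
    have hlim : Filter.Tendsto (fun s : ℝ => w s(0, 1) * w s(0, 2) / s ^ 2) Filter.atTop (nhds 0) :=
      Filter.Tendsto.const_div_atTop (Filter.tendsto_pow_atTop two_ne_zero) _
    obtain ⟨M, hM⟩ := Filter.eventually_atTop.mp
      ((hlim.eventually_ne hw.symm).and (Filter.eventually_ne_atTop 0))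
    obtain ⟨N, hN⟩ := exists_nat_ge M
    exact ⟨N, fun s hs => ⟨(hM s (hN.trans hs.le)).2, (hM s (hN.trans hs.le)).1.symm⟩⟩
  have hs : ∀ i : ℕ, (N : ℝ) < N + 1 + i := fun i => by
    have : (0 : ℝ) ≤ i := i.cast_nonneg
    linarith
  choose Y Z h1 h2 h3 h4 h5 h6 using fun i : ℕ =>
    exists_triangle (w s(0, 1)) (w s(1, 2)) (w s(0, 2)) (hN _ (hs i)).1 (hN _ (hs i)).2
  let P : ℕ → Plane := fun i => !₂[(N : ℝ) + 1 + i, 0]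
  have hcard : ((range k).biUnion fun i => {P i, Y i, Z i}).card ≤ n := by
    refine card_biUnion_le.trans ((sum_le_card_nsmul _ _ 3 fun i _ => card_le_three).trans ?_)
    rw [card_range, smul_eq_mul]
    omega
  obtain ⟨E, hsub, hE⟩ := Infinite.exists_superset_card_eq _ n hcard
  have hmem : ∀ i ∈ range k, P i ∈ E ∧ Y i ∈ E ∧ Z i ∈ E := fun i hi => by
    refine ⟨?_, ?_, ?_⟩ <;> exact hsub (mem_biUnion.mpr ⟨i, hi, by simp⟩)
  let φ : Fin 3 ≃ Fin (Fintype.card (Fin 3)) := finCongr (Fintype.card_fin 3).symm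
  let x : ℕ → Fin (Fintype.card (Fin 3)) → Plane := fun i j => ![P i, Y i, Z i] (φ.symm j)
  have hx : Set.InjOn x (range k) := by
    intro i _ j _ hij
    have h := congrArg (fun v : Plane => v 0) (congrFun hij (φ 0))
    simpa [x, P] using h
  refine le_trans ?_ ((isGreatest_maxDotProductConfigs _ w n).2 ⟨E, hE, rfl⟩)
  calc k = (x '' (range k)).ncard := by
        rw [hx.ncard_image, Set.ncard_coe_finset, card_range]
    _ ≤ _ := Set.ncard_le_ncard ?_
      ((finite_toSet _).subset (dotProductConfigs_subset _ w E))
  rintro _ ⟨i, hi, rfl⟩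
  obtain ⟨hP, hY, hZ⟩ := hmem i (mem_coe.mp hi)
  refine ⟨fun j => ?_, isDotProductConfig_cycleGraph_three_iff.mpr ⟨?_, φ, ?_, ?_, ?_⟩⟩
  · obtain ⟨j, rfl⟩ := φ.surjective j
    simp only [x, Equiv.symm_apply_apply]
    fin_cases j
    exacts [hP, hY, hZ]
  · have hinj : Function.Injective ![P i, Y i, Z i] := by
      intro j l hjl
      fin_cases j <;> fin_cases l <;> first
        | rfl
        | exact absurd hjl (h1 i)
        | exact absurd hjl (h2 i)
        | exact absurd hjl (h3 i)
        | exact absurd hjl.symm (h1 i)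
        | exact absurd hjl.symm (h2 i)
        | exact absurd hjl.symm (h3 i)
    exact hinj.comp φ.symm.injective
  · simp only [x, Equiv.symm_apply_apply]
    exact h4 i
  · simp only [x, Equiv.symm_apply_apply]
    exact h5 i
  · simp only [x, Equiv.symm_apply_apply]
    exact h6 i

end DotProducts

theorem mainTheorem2 :
    ∃ (C : ℝ) (N : ℕ), ∀ w : Sym2 (Fin 3) → ℝ,
      (∀ e ∈ (SimpleGraph.cycleGraph 3).edgeSet, w e ≠ 0) →
      ∀ n : ℕ, n > N →
        (n : ℝ) ≤ C * (maxDotProductConfigs (SimpleGraph.cycleGraph 3) w n : ℝ) ∧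
        (maxDotProductConfigs (SimpleGraph.cycleGraph 3) w n : ℝ) ≤
          C * (n : ℝ) ^ ((4 : ℝ) / 3) := by
  refine ⟨60, 2, fun w hw n hn => ?_⟩
  have hne : ∀ u v : Fin 3, u ≠ v → w s(u, v) ≠ 0 := fun u v huv =>
    hw _ ((SimpleGraph.cycleGraph 3).mem_edgeSet.mpr (cycleGraph_three_adj.mpr huv))
  constructor
  · have h := le_maxDotProductConfigs w (hne 1 2 (by decide)) (n := n) (k := n / 3)
      (Nat.mul_div_le n 3)
    have : n ≤ 60 * maxDotProductConfigs (SimpleGraph.cycleGraph 3) w n := by omega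
    exact_mod_cast this
  · obtain ⟨E, hE, hmax⟩ := (isGreatest_maxDotProductConfigs (SimpleGraph.cycleGraph 3) w n).1
    have h1 : maxDotProductConfigs (SimpleGraph.cycleGraph 3) w n ≤
        6 * ((dotPairs E (w s(0, 1))).card + (dotPairs E (w s(0, 2))).card) := by
      rw [← hmax]
      exact (ncard_dotProductConfigs_le w E).trans
        (Nat.mul_le_mul_left 6 (card_dotTriples_le E _ (hne 0 2 (by decide))))
    have h2 : (maxDotProductConfigs (SimpleGraph.cycleGraph 3) w n : ℝ) ≤
        6 * ((dotPairs E (w s(0, 1))).card + (dotPairs E (w s(0, 2))).card) := by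
      exact_mod_cast h1
    have h3 := card_dotPairs_le (by omega) hE (hne 0 1 (by decide))
    have h4 := card_dotPairs_le (by omega) hE (hne 0 2 (by decide))
    linarith
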